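/- All topological spaces are Hausdorff. Let $(E,\tau)$ be a (Hausdorff) locally convex space over $\mathbb{R}$ or $\mathbb{C}$ with a fundamental sequence $(B_n)_{n\in\mathbb{N}}$ of bounded sets, that is, every $B_n$ is bounded and every bounded subset of $E$ is contained in some $B_n$. Then there exists a finest topology $\xi$ among the locally convex topologies on $E$ that have the same bounded sets as $\tau$; moreover: (1) $(E,\xi)$ has a $\mathfrak{G}$-base, that is, a base $\{U_\alpha:\alpha\in\mathbb{N}^{\mathbb{N}}\}$ of neighbourhoods of zero such that $U_\beta\subseteq U_\alpha$ whenever $\alpha\le\beta$ coordinatewise. (2) $(E,\xi)$ has the strong Pytkeev property: for each $x\in E$ there is a countable family $\mathcal{D}$ of subsets of $E$ such that for every $\xi$-neighbourhood $U$ of $x$ and every $A\subseteq E$ with $x\in\overline{A}\setminus A$ (closure in $\xi$) there is $D\in\mathcal{D}$ such that $D\subseteq U$ and $D\cap A$ is infinite. (3) If $(E,\tau)$ is bornological, that is, every absolutely convex subset of $E$ which absorbs all bounded sets is a $\tau$-neighbourhood of zero, then $\tau=\xi$. -/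

import Mathlib

open Set Topology

/-- `t` makes the vector space `E` over `𝕜` (real or complex) a Hausdorff locally convex space.
Convexity is convexity over the real numbers. -/
structure IsLCSTopology (𝕜 : Type*) {E : Type*} [RCLike 𝕜] [AddCommGroup E] [Module 𝕜 E]
    [Module ℝ E] (t : TopologicalSpace E) : Prop where
  isTopologicalAddGroup : IsTopologicalAddGroup E
  continuousSMul : ContinuousSMul 𝕜 E
  locallyConvexSpace : LocallyConvexSpace ℝ E
  t2Space : T2Space E

/-- `s` is bounded in `(E, t)`: every `t`-neighbourhood of zero absorbs `s`. -/
def IsBoundedIn (𝕜 : Type*) {E : Type*} [RCLike 𝕜] [AddCommGroup E] [Module 𝕜 E]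
    (t : TopologicalSpace E) (s : Set E) : Prop :=
  Bornology.IsVonNBounded 𝕜 s

/-- `B` is a fundamental sequence of bounded sets of `(E, t)`: every `B n` is bounded, and every
bounded set lies in some `B n`. -/
def IsFundamentalBoundedSeq (𝕜 : Type*) {E : Type*} [RCLike 𝕜] [AddCommGroup E] [Module 𝕜 E]
    (t : TopologicalSpace E) (B : ℕ → Set E) : Prop :=
  (∀ n, IsBoundedIn 𝕜 t (B n)) ∧ ∀ s : Set E, IsBoundedIn 𝕜 t s → ∃ n, s ⊆ B n

/-- `ξ` is the finest among the locally convex topologies with the same bounded sets as `τ`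
(in Mathlib's order on topologies, `t ≤ t'` means that `t` is finer than `t'`). -/
def IsFinestLCSWithSameBounded (𝕜 : Type*) {E : Type*} [RCLike 𝕜] [AddCommGroup E] [Module 𝕜 E]
    [Module ℝ E] (τ ξ : TopologicalSpace E) : Prop :=
  IsLeast {t : TopologicalSpace E |
    IsLCSTopology 𝕜 t ∧ ∀ s : Set E, IsBoundedIn 𝕜 t s ↔ IsBoundedIn 𝕜 τ s} ξ

/-- `s` is bornivorous in `(E, t)`: it absorbs every bounded set. -/
def IsBornivorous (𝕜 : Type*) {E : Type*} [RCLike 𝕜] [AddCommGroup E] [Module 𝕜 E]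
    (t : TopologicalSpace E) (s : Set E) : Prop :=
  ∀ b : Set E, IsBoundedIn 𝕜 t b → Absorbs 𝕜 s b

/-- `(E, t)` is bornological: every absolutely convex bornivorous set is a neighbourhood of
zero. (Used for locally convex `t`.) -/
def IsBornological (𝕜 : Type*) {E : Type*} [RCLike 𝕜] [AddCommGroup E] [Module 𝕜 E]
    [Module ℝ E] (t : TopologicalSpace E) : Prop :=
  ∀ s : Set E, Balanced 𝕜 s → Convex ℝ s → IsBornivorous 𝕜 t s → s ∈ 𝓝 (0 : E)

/-- `(E, t)` has a `𝔊`-base: a base `(U α)` of neighbourhoods of zero indexed by `ℕ → ℕ` with the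
coordinatewise order, such that `U β ⊆ U α` whenever `α ≤ β`. -/
def HasGBase {E : Type*} [AddCommGroup E] (t : TopologicalSpace E) : Prop :=
  ∃ U : (ℕ → ℕ) → Set E, Antitone U ∧ (𝓝 (0 : E)).HasBasis (fun _ => True) U

/-- `(X, t)` has the strong Pytkeev property. -/
def StrongPytkeev {X : Type*} (t : TopologicalSpace X) : Prop :=
  ∀ x : X, ∃ D : Set (Set X), D.Countable ∧
    ∀ U ∈ 𝓝 x, ∀ A : Set X, x ∈ closure A \ A → ∃ N ∈ D, N ⊆ U ∧ (N ∩ A).Infinite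

/-!
The topology `ξ` is the bornological topology attached to `τ`: its basic neighbourhoods of zero are
the disks (absolutely convex sets) that absorb every `τ`-bounded set. Every absolutely convex
neighbourhood of zero of a locally convex topology with the bounded sets of `τ` is such a disk, so
`ξ` is finer than all of these topologies, in particular finer than `τ`, hence Hausdorff; and it has
the same bounded sets by construction (`bornologicalTopology_isFinest`).

If `B` is a fundamental sequence of bounded sets, the disks
`U α = ⋃ k, absconv (⋃ n < k, (α n + 1)⁻¹ • B n)` form a base at zero (`hasBasis_weightedDisk`):
each `U α` absorbs every `B n`, and a bornivorous disk contains some multiple of every `B n`, so it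
contains some `U α`. Clearly `U` is antitone.

Each `U α` is an increasing union of stages, the `k`-th of which depends only on
`α 0, …, α (k - 1)`. So `U α` is covered by the sets `D k α`, the intersection of all `U β` with `β`
in the cylinder of length `k` around `α`. There are countably many sets `D k α`. If each of them met
`A` in a finite set, a diagonal argument would yield `γ ≥ α` with `U γ` disjoint from `A`. This is
the strong Pytkeev property (`exists_countable_pytkeev_family`).
-/

open Filter
open scoped Pointwise

/-! ### Antitone bases indexed by sequences and the strong Pytkeev property -/

/-- An antitone base `U` at `x` yields the strong Pytkeev property at `x` if each `U α` is covered
by the countably many sets `⋂ β ∈ cylinder α k, U β`. -/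
theorem exists_countable_pytkeev_family {X : Type*} [TopologicalSpace X] [T1Space X] {x : X}
    {U : (ℕ → ℕ) → Set X} (hU : Antitone U) (hb : (𝓝 x).HasBasis (fun _ => True) U)
    (hcov : ∀ α, U α ⊆ ⋃ k, ⋂ β ∈ PiNat.cylinder α k, U β) :
    ∃ D : Set (Set X), D.Countable ∧
      ∀ V ∈ 𝓝 x, ∀ A : Set X, x ∈ closure A \ A → ∃ N ∈ D, N ⊆ V ∧ (N ∩ A).Infinite := by
  refine ⟨range fun p : Σ k, Fin k → ℕ => ⋂ β ∈ {β : ℕ → ℕ | ∀ i : Fin p.1, β i = p.2 i}, U β,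
    countable_range _, fun V hV A hA => ?_⟩
  obtain ⟨α, -, hαV⟩ := hb.mem_iff.1 hV
  let N : ℕ → Set X := fun k => ⋂ β ∈ PiNat.cylinder α k, U β
  by_contra! hfin
  replace hfin : ∀ k, (N k ∩ A).Finite := fun k => by
    refine hfin (N k) ⟨⟨k, fun i => α i⟩, ?_⟩
      ((biInter_subset_of_mem (PiNat.self_mem_cylinder α k)).trans hαV)
    have : {β : ℕ → ℕ | ∀ i : Fin k, β i = α i} = PiNat.cylinder α k := by
      ext β; simp [PiNat.cylinder, Fin.forall_iff]
    simp only [N, ← this]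
  -- A point of `A` outside `N k` is missed by some `U β` with `β` in the cylinder of length `k`;
  -- finitely many such points are missed simultaneously by the supremum of the sequences found.
  have hmiss : ∀ k, ∃ β ∈ PiNat.cylinder α k, Disjoint (U β) ((N (k + 1) ∩ A) \ N k) := fun k => by
    have key : ∀ F : Set X, F.Finite → Disjoint F (N k) →
        ∃ β ∈ PiNat.cylinder α k, Disjoint (U β) F := fun F hF => by
      induction F, hF using Set.Finite.induction_on with
      | empty => exact fun _ => ⟨α, PiNat.self_mem_cylinder α k, disjoint_empty _⟩
      | @insert a F _ _ ih =>
        intro hd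
        obtain ⟨ha, hd⟩ := disjoint_insert_left.1 hd
        obtain ⟨β, hβ, hβF⟩ := ih hd
        obtain ⟨δ, hδ, haδ⟩ : ∃ δ ∈ PiNat.cylinder α k, a ∉ U δ := by simpa [N] using ha
        refine ⟨β ⊔ δ, fun i hi => by simp [hβ i hi, hδ i hi], disjoint_insert_right.2 ⟨?_, ?_⟩⟩
        · exact fun h => haδ (hU le_sup_right h)
        · exact hβF.mono_left (hU le_sup_left)
    exact key _ ((hfin (k + 1)).subset sdiff_subset) disjoint_sdiff_left
  choose β hβ hβd using hmiss
  -- `γ` dominates `α` and every `β k`: only `k ≤ i` matters at coordinate `i`, since `β k i = α i`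
  -- for `i < k`.
  let γ : ℕ → ℕ := fun i => α i + ∑ k ∈ Finset.range (i + 1), β k i
  have hαγ : α ≤ γ := fun i => Nat.le_add_right _ _
  have hβγ : ∀ k, β k ≤ γ := fun k i => by
    rcases lt_or_ge i k with hi | hi
    · exact (hβ k i hi).trans_le (hαγ i)
    · exact (Finset.single_le_sum (f := fun k => β k i) (fun _ _ => Nat.zero_le _)
        (Finset.mem_range.2 (Nat.lt_succ_of_le hi))).trans (Nat.le_add_left _ _)
  obtain ⟨a, haU, haA⟩ := mem_closure_iff_nhds.1 hA.1 (U γ) (hb.mem_of_mem trivial)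
  obtain ⟨m, hm⟩ := mem_iUnion.1 (hcov α (hU hαγ haU))
  -- `N 0` is the intersection of all basic neighbourhoods, that is, `{x}`.
  have h0 : a ∉ N 0 := fun h => by
    refine hA.2 ?_
    have hax : a = x := by
      by_contra hne
      obtain ⟨δ, -, hδ⟩ := hb.mem_iff.1 (isOpen_compl_singleton.mem_nhds (Ne.symm hne))
      exact hδ (mem_iInter₂.1 h δ (by simp)) rfl
    exact hax ▸ haA
  obtain ⟨k, hk, hk'⟩ : ∃ k, a ∉ N k ∧ a ∈ N (k + 1) := by
    by_contra! hstep
    exact Nat.rec (motive := fun k => a ∉ N k) h0 hstep m hm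
  exact disjoint_left.1 (hβd k) (hU (hβγ k) haU) ⟨⟨hk', haA⟩, hk⟩

/-! ### Disks -/

section Disk

variable {𝕜 E : Type*} [RCLike 𝕜] [AddCommGroup E] [Module 𝕜 E] [Module ℝ E]

/-- Real convex hulls preserve balancedness over `𝕜`. -/
theorem Balanced.convexHull_real [IsScalarTower ℝ 𝕜 E] {s : Set E} (hs : Balanced 𝕜 s) :
    Balanced 𝕜 (convexHull ℝ s) := fun a ha => by
  have : SMulCommClass 𝕜 ℝ E := IsScalarTower.to_smulCommClass' (R := ℝ) (A := 𝕜) (M := E)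
  have h := (DistribSMul.toLinearMap ℝ E a).image_convexHull s
  calc a • convexHull ℝ s = convexHull ℝ (a • s) := h
    _ ⊆ convexHull ℝ s := convexHull_mono (hs a ha)

theorem Convex.smul_rclike [IsScalarTower ℝ 𝕜 E] {s : Set E} (hs : Convex ℝ s) (c : 𝕜) : Convex ℝ (c • s) := by
  have : SMulCommClass 𝕜 ℝ E := IsScalarTower.to_smulCommClass' (R := ℝ) (A := 𝕜) (M := E)
  exact hs.linear_image (DistribSMul.toLinearMap ℝ E c)

theorem exists_balanced_convex_mem_nhds_zero [IsScalarTower ℝ 𝕜 E] [TopologicalSpace E]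
    [ContinuousSMul 𝕜 E] [LocallyConvexSpace ℝ E] {V : Set E} (hV : V ∈ 𝓝 (0 : E)) :
    ∃ W ∈ 𝓝 (0 : E), Balanced 𝕜 W ∧ Convex ℝ W ∧ W ⊆ V := by
  obtain ⟨S, ⟨hS, hSc⟩, hSV⟩ := (LocallyConvexSpace.convex_basis_zero ℝ E).mem_iff.1 hV
  exact ⟨convexHull ℝ (balancedCore 𝕜 S),
    mem_of_superset (balancedCore_mem_nhds_zero hS) (subset_convexHull ℝ _),
    (balancedCore_balanced S).convexHull_real, convex_convexHull ℝ _,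
    (convexHull_min (balancedCore_subset S) hSc).trans hSV⟩

/-- `s` is a bornivorous disk of `(E, τ)`: an absolutely convex set that absorbs the bounded
sets. -/
structure IsBornivorousDisk (𝕜 : Type*) {E : Type*} [RCLike 𝕜] [AddCommGroup E] [Module 𝕜 E]
    [Module ℝ E] (τ : TopologicalSpace E) (s : Set E) : Prop where
  balanced : Balanced 𝕜 s
  convex : Convex ℝ s
  bornivorous : IsBornivorous 𝕜 τ s

namespace IsBornivorousDisk

variable {τ : TopologicalSpace E} {s t : Set E}

theorem univ : IsBornivorousDisk 𝕜 τ (univ : Set E) :=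
  ⟨balanced_univ, convex_univ, fun _ _ => .univ⟩

theorem inter (hs : IsBornivorousDisk 𝕜 τ s) (ht : IsBornivorousDisk 𝕜 τ t) :
    IsBornivorousDisk 𝕜 τ (s ∩ t) :=
  ⟨hs.balanced.inter ht.balanced, hs.convex.inter ht.convex,
    fun b hb => (hs.bornivorous b hb).inter (ht.bornivorous b hb)⟩

theorem smul [IsScalarTower ℝ 𝕜 E] (hs : IsBornivorousDisk 𝕜 τ s) {c : 𝕜} (hc : c ≠ 0) :
    IsBornivorousDisk 𝕜 τ (c • s) := by
  refine ⟨hs.balanced.smul c, hs.convex.smul_rclike c, fun b hb => ?_⟩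
  obtain ⟨r, hr⟩ := absorbs_iff_norm.1 (hs.bornivorous b hb)
  refine absorbs_iff_norm.2 ⟨r / ‖c‖, fun a ha => ?_⟩
  rw [smul_smul]
  refine hr _ ?_
  rwa [norm_mul, ← div_le_iff₀ (norm_pos_iff.2 hc)]

theorem absorbs_singleton (hτ : IsLCSTopology 𝕜 τ) (hs : IsBornivorousDisk 𝕜 τ s) (x : E) :
    Absorbs 𝕜 s {x} := by
  have := hτ.continuousSMul
  exact hs.bornivorous _ (Bornology.isVonNBounded_singleton x)

theorem zero_mem (hτ : IsLCSTopology 𝕜 τ) (hs : IsBornivorousDisk 𝕜 τ s) : (0 : E) ∈ s :=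
  absorbs_zero_iff.1 (hs.absorbs_singleton hτ 0)

end IsBornivorousDisk

end Disk

/-! ### The associated bornological topology -/

section BornologicalTopology

variable {𝕜 E : Type*} [RCLike 𝕜] [AddCommGroup E] [Module 𝕜 E] [Module ℝ E]
  [IsScalarTower ℝ 𝕜 E]

/-- The bornivorous disks as a filter basis compatible with the module structure. -/
def bornivorousDiskBasis {τ : TopologicalSpace E} (hτ : IsLCSTopology 𝕜 τ) :
    ModuleFilterBasis 𝕜 E where
  sets := {s | IsBornivorousDisk 𝕜 τ s}
  nonempty := ⟨univ, .univ⟩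
  inter_sets {s t} hs ht := ⟨s ∩ t, IsBornivorousDisk.inter hs ht, Subset.rfl⟩
  zero' {s} hs := IsBornivorousDisk.zero_mem hτ hs
  add' {s} hs := by
    have hs : IsBornivorousDisk 𝕜 τ s := hs
    refine ⟨(2⁻¹ : 𝕜) • s, hs.smul (by simp), ?_⟩
    rintro _ ⟨_, ⟨x, hx, rfl⟩, _, ⟨y, hy, rfl⟩, rfl⟩
    have h := hs.convex hx hy (a := 2⁻¹) (b := 2⁻¹) (by norm_num) (by norm_num) (by norm_num)
    have hcast : ∀ z : E, (2⁻¹ : 𝕜) • z = (2⁻¹ : ℝ) • z := fun z => by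
      rw [← algebraMap_smul 𝕜 (2⁻¹ : ℝ) z, map_inv₀, map_ofNat]
    simpa only [hcast] using h
  neg' {s} hs := ⟨s, hs, fun x hx => (IsBornivorousDisk.balanced hs).neg_mem_iff.2 hx⟩
  conj' x₀ s hs := ⟨s, hs, fun x hx => by simpa using hx⟩
  smul' {s} hs := by
    refine ⟨Metric.closedBall 0 1, Metric.closedBall_mem_nhds 0 one_pos, s, hs, ?_⟩
    exact balanced_iff_closedBall_smul.1 (IsBornivorousDisk.balanced hs)
  smul_left' c s hs := by
    rcases eq_or_ne c 0 with rfl | hc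
    · exact ⟨s, hs, fun x _ => by simpa using IsBornivorousDisk.zero_mem hτ hs⟩
    · refine ⟨c⁻¹ • s, IsBornivorousDisk.smul hs (inv_ne_zero hc), ?_⟩
      rintro _ ⟨x, hx, rfl⟩
      simpa [smul_inv_smul₀ hc] using hx
  smul_right' x s hs := by
    simpa [MapsTo] using (IsBornivorousDisk.absorbs_singleton hτ hs x).eventually_nhds_zero
      (IsBornivorousDisk.zero_mem hτ hs)

/-- The bornological topology associated with `τ`: the bornivorous disks form a base at zero. -/
@[reducible]
def bornologicalTopology {τ : TopologicalSpace E} (hτ : IsLCSTopology 𝕜 τ) : TopologicalSpace E :=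
  (bornivorousDiskBasis hτ).topology

variable {τ : TopologicalSpace E}

theorem bornologicalTopology_hasBasis (hτ : IsLCSTopology 𝕜 τ) :
    (@nhds E (bornologicalTopology hτ) 0).HasBasis (IsBornivorousDisk 𝕜 τ) id :=
  (bornivorousDiskBasis hτ).toAddGroupFilterBasis.nhds_zero_hasBasis

theorem bornologicalTopology_isTopologicalAddGroup (hτ : IsLCSTopology 𝕜 τ) :
    @IsTopologicalAddGroup E (bornologicalTopology hτ) _ :=
  (bornivorousDiskBasis hτ).toAddGroupFilterBasis.isTopologicalAddGroup

/-- An absolutely convex neighbourhood of zero for `t` absorbs all `t`-bounded sets, so it is a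
bornivorous disk of `τ` as soon as the `τ`-bounded sets are `t`-bounded. -/
theorem bornologicalTopology_le (hτ : IsLCSTopology 𝕜 τ) {t : TopologicalSpace E}
    (ht : IsLCSTopology 𝕜 t) (hb : ∀ s : Set E, IsBoundedIn 𝕜 τ s → IsBoundedIn 𝕜 t s) :
    bornologicalTopology hτ ≤ t := by
  have := ht.isTopologicalAddGroup
  have := ht.continuousSMul
  have := ht.locallyConvexSpace
  have hξ := bornologicalTopology_isTopologicalAddGroup hτ
  refine (le_iff_nhds _ _).2 fun x => ?_
  rw [← @map_add_left_nhds_zero E t _ _ x,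
    ← @map_add_left_nhds_zero E (bornologicalTopology hτ) _ _ x]
  refine map_mono fun V hV => ?_
  obtain ⟨W, hW, hWb, hWc, hWV⟩ := exists_balanced_convex_mem_nhds_zero (𝕜 := 𝕜) hV
  exact (bornologicalTopology_hasBasis hτ).mem_iff.2
    ⟨W, ⟨hWb, hWc, fun b hbd => hb b hbd hW⟩, hWV⟩

theorem bornologicalTopology_isLCS (hτ : IsLCSTopology 𝕜 τ) :
    IsLCSTopology 𝕜 (bornologicalTopology hτ) where
  isTopologicalAddGroup := bornologicalTopology_isTopologicalAddGroup hτ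
  continuousSMul := (bornivorousDiskBasis hτ).continuousSMul
  locallyConvexSpace := by
    let _ := bornologicalTopology hτ
    have := bornologicalTopology_isTopologicalAddGroup hτ
    exact .ofBasisZero ℝ E _ _ (bornologicalTopology_hasBasis hτ) fun _ hs => hs.convex
  t2Space := t2Space_antitone (bornologicalTopology_le hτ hτ fun _ h => h) hτ.t2Space

theorem isBoundedIn_bornologicalTopology_iff (hτ : IsLCSTopology 𝕜 τ) (s : Set E) :
    IsBoundedIn 𝕜 (bornologicalTopology hτ) s ↔ IsBoundedIn 𝕜 τ s := by
  refine ⟨fun h => ?_, fun h => ?_⟩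
  · exact Bornology.IsVonNBounded.of_topologicalSpace_le
      (bornologicalTopology_le hτ hτ fun _ h => h) h
  · let _ := bornologicalTopology hτ
    exact (bornologicalTopology_hasBasis hτ).isVonNBounded_iff.2 fun V hV => hV.bornivorous s h

theorem bornologicalTopology_isFinest (hτ : IsLCSTopology 𝕜 τ) :
    IsFinestLCSWithSameBounded 𝕜 τ (bornologicalTopology hτ) :=
  ⟨⟨bornologicalTopology_isLCS hτ, isBoundedIn_bornologicalTopology_iff hτ⟩,
    fun _ ht => bornologicalTopology_le hτ ht.1 fun s => (ht.2 s).2⟩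

theorem eq_bornologicalTopology (hτ : IsLCSTopology 𝕜 τ) (h : IsBornological 𝕜 τ) :
    τ = bornologicalTopology hτ := by
  refine IsTopologicalAddGroup.ext hτ.isTopologicalAddGroup
    (bornologicalTopology_isTopologicalAddGroup hτ) (le_antisymm ?_ ?_)
  · exact (bornologicalTopology_hasBasis hτ).ge_iff.2
      fun s hs => h s hs.balanced hs.convex hs.bornivorous
  · exact (le_iff_nhds _ _).1 (bornologicalTopology_le hτ hτ fun _ h => h) 0

end BornologicalTopology

/-! ### The base indexed by sequences -/

section WeightedDisk

variable {𝕜 E : Type*} [RCLike 𝕜] [AddCommGroup E] [Module 𝕜 E] [Module ℝ E]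

variable (𝕜) in
/-- The absolutely convex hull (over `𝕜`) of the sets `(α n + 1)⁻¹ • B n` with `n < k`. -/
def weightedDiskStage (B : ℕ → Set E) (α : ℕ → ℕ) (k : ℕ) : Set E :=
  convexHull ℝ (balancedHull 𝕜 (⋃ n < k, ((α n + 1 : 𝕜)⁻¹) • B n))

variable (𝕜) in
/-- The absolutely convex hull of all the sets `(α n + 1)⁻¹ • B n`, written as the increasing union
of the hulls of finitely many of them. The weight `α n + 1` avoids dividing by zero. -/
def weightedDisk (B : ℕ → Set E) (α : ℕ → ℕ) : Set E :=
  ⋃ k, weightedDiskStage 𝕜 B α k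

variable {τ : TopologicalSpace E} {B : ℕ → Set E}

theorem weightedDiskStage_subset_iff {α : ℕ → ℕ} {k : ℕ} {s : Set E} (hb : Balanced 𝕜 s)
    (hc : Convex ℝ s) :
    weightedDiskStage 𝕜 B α k ⊆ s ↔ ∀ n < k, ((α n + 1 : 𝕜)⁻¹) • B n ⊆ s := by
  rw [← iUnion₂_subset_iff]
  exact ⟨fun h => ((subset_balancedHull 𝕜).trans (subset_convexHull ℝ _)).trans h,
    fun h => convexHull_min (hb.balancedHull_subset_of_subset h) hc⟩

theorem norm_natCast_add_one (m : ℕ) : ‖(m + 1 : 𝕜)‖ = m + 1 := by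
  exact_mod_cast RCLike.norm_natCast (K := 𝕜) (m + 1)

/-- A bornivorous disk contains a positive multiple of each `B n`, hence a weighted disk. -/
theorem exists_weightedDisk_subset (hB : IsFundamentalBoundedSeq 𝕜 τ B) {s : Set E}
    (hs : IsBornivorousDisk 𝕜 τ s) : ∃ α, weightedDisk 𝕜 B α ⊆ s := by
  have h : ∀ n, ∃ m : ℕ, ((m + 1 : 𝕜)⁻¹) • B n ⊆ s := fun n => by
    obtain ⟨r, hr⟩ := absorbs_iff_norm.1 (hs.bornivorous _ (hB.1 n))
    obtain ⟨m, hm⟩ := exists_nat_ge r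
    refine ⟨m, (subset_smul_set_iff₀ (Nat.cast_add_one_ne_zero _)).1 (hr _ ?_)⟩
    rw [norm_natCast_add_one]
    linarith
  choose α hα using h
  exact ⟨α, iUnion_subset fun k =>
    (weightedDiskStage_subset_iff hs.balanced hs.convex).2 fun n _ => hα n⟩

variable [IsScalarTower ℝ 𝕜 E]

theorem balanced_weightedDiskStage (α : ℕ → ℕ) (k : ℕ) :
    Balanced 𝕜 (weightedDiskStage 𝕜 B α k) :=
  (balancedHull.balanced _).convexHull_real

theorem smul_subset_weightedDiskStage (α : ℕ → ℕ) {n k : ℕ} (hn : n < k) :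
    ((α n + 1 : 𝕜)⁻¹) • B n ⊆ weightedDiskStage 𝕜 B α k :=
  (weightedDiskStage_subset_iff (balanced_weightedDiskStage α k) (convex_convexHull ℝ _)).1
    Subset.rfl n hn

theorem monotone_weightedDiskStage (α : ℕ → ℕ) : Monotone (weightedDiskStage 𝕜 B α) :=
  fun _ k hjk => (weightedDiskStage_subset_iff (balanced_weightedDiskStage α k)
    (convex_convexHull ℝ _)).2 fun _ hn => smul_subset_weightedDiskStage α (hn.trans_le hjk)

theorem antitone_weightedDisk : Antitone (weightedDisk 𝕜 B) := fun α β hαβ =>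
  iUnion_mono fun k => (weightedDiskStage_subset_iff (balanced_weightedDiskStage α k)
    (convex_convexHull ℝ _)).2 fun n hn => by
    rintro _ ⟨x, hx, rfl⟩
    refine (balanced_weightedDiskStage α k).smul_mem_mono
      (smul_subset_weightedDiskStage α hn (smul_mem_smul_set hx)) ?_
    simp only [norm_inv, norm_natCast_add_one]
    have : (α n : ℝ) ≤ β n := by exact_mod_cast hαβ n
    gcongr

theorem isBornivorousDisk_weightedDisk (hB : IsFundamentalBoundedSeq 𝕜 τ B) (α : ℕ → ℕ) :
    IsBornivorousDisk 𝕜 τ (weightedDisk 𝕜 B α) := by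
  have hbal : Balanced 𝕜 (weightedDisk 𝕜 B α) := balanced_iUnion (balanced_weightedDiskStage α)
  refine ⟨hbal, (monotone_weightedDiskStage α).directed_le.convex_iUnion
    fun k => convex_convexHull ℝ _, fun b hb => ?_⟩
  obtain ⟨n, hn⟩ := hB.2 b hb
  refine absorbs_iff_norm.2 ⟨α n + 1, fun c hc => hn.trans ?_⟩
  rw [← norm_natCast_add_one (𝕜 := 𝕜)] at hc
  refine Subset.trans ?_ (hbal.smul_mono hc)
  have h0 : (α n + 1 : 𝕜) ≠ 0 := Nat.cast_add_one_ne_zero _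
  rw [subset_smul_set_iff₀ h0]
  exact (smul_subset_weightedDiskStage α n.lt_succ_self).trans (subset_iUnion _ (n + 1))

theorem hasBasis_weightedDisk (hτ : IsLCSTopology 𝕜 τ) (hB : IsFundamentalBoundedSeq 𝕜 τ B) :
    (@nhds E (bornologicalTopology hτ) 0).HasBasis (fun _ => True) (weightedDisk 𝕜 B) :=
  (bornologicalTopology_hasBasis hτ).to_hasBasis
    (fun _ hs => (exists_weightedDisk_subset hB hs).imp fun _ h => ⟨trivial, h⟩)
    fun α _ => ⟨_, isBornivorousDisk_weightedDisk hB α, Subset.rfl⟩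

/-- The `k`-th stage only depends on the first `k` terms of the sequence, so it lies in `U β` for
every `β` with the same first `k` terms. -/
theorem weightedDisk_subset_iUnion_iInter_cylinder (α : ℕ → ℕ) :
    weightedDisk 𝕜 B α ⊆ ⋃ k, ⋂ β ∈ PiNat.cylinder α k, weightedDisk 𝕜 B β := by
  refine iUnion_mono fun k => subset_iInter₂ fun β hβ => ?_
  refine Subset.trans ?_ (subset_iUnion _ k)
  refine (weightedDiskStage_subset_iff (balanced_weightedDiskStage β k)
    (convex_convexHull ℝ _)).2 fun n hn => ?_
  rw [← hβ n hn]
  exact smul_subset_weightedDiskStage β hn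

theorem strongPytkeev_bornologicalTopology (hτ : IsLCSTopology 𝕜 τ)
    (hB : IsFundamentalBoundedSeq 𝕜 τ B) : StrongPytkeev (bornologicalTopology hτ) := by
  let _ := bornologicalTopology hτ
  have := bornologicalTopology_isTopologicalAddGroup hτ
  have := (bornologicalTopology_isLCS hτ).t2Space
  intro x
  have hbx : (𝓝 x).HasBasis (fun _ => True) fun α => (x + ·) '' weightedDisk 𝕜 B α := by
    rw [← map_add_left_nhds_zero x]
    exact (hasBasis_weightedDisk hτ hB).map _
  refine exists_countable_pytkeev_family
    (fun _ _ h => image_mono (antitone_weightedDisk h)) hbx fun α => ?_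
  rintro _ ⟨y, hy, rfl⟩
  obtain ⟨k, hk⟩ := mem_iUnion.1 (weightedDisk_subset_iUnion_iInter_cylinder α hy)
  exact mem_iUnion.2 ⟨k, mem_iInter₂.2 fun β hβ => mem_image_of_mem _ (mem_iInter₂.1 hk β hβ)⟩

end WeightedDisk

theorem lemma3p10 {𝕜 E : Type*} [RCLike 𝕜] [AddCommGroup E] [Module 𝕜 E] [Module ℝ E]
    [IsScalarTower ℝ 𝕜 E] (τ : TopologicalSpace E) (hτ : IsLCSTopology 𝕜 τ)
    (B : ℕ → Set E) (hB : IsFundamentalBoundedSeq 𝕜 τ B) :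
    ∃ ξ : TopologicalSpace E, IsFinestLCSWithSameBounded 𝕜 τ ξ ∧
      HasGBase ξ ∧ StrongPytkeev ξ ∧ (IsBornological 𝕜 τ → τ = ξ) :=
  ⟨bornologicalTopology hτ, bornologicalTopology_isFinest hτ,
    ⟨weightedDisk 𝕜 B, antitone_weightedDisk, hasBasis_weightedDisk hτ hB⟩,
    strongPytkeev_bornologicalTopology hτ hB, eq_bornologicalTopology hτ⟩
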